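/- Let $k=\mathbb R$ or $\mathbb C$, let $R$ be a (complete Hausdorff locally convex) topological commutative dg algebra over $k$ with a nilpotent ideal, and let $\mathfrak g$ be a curved $L_\infty$ algebra over $R$ that is free of finite rank as a graded $R^\#$-module. Consider one-dimensional Chern--Simons theory on the circle $S^1=\mathbb R/\ell\mathbb Z$ ($\ell>0$) with values in $\mathfrak g\oplus\mathfrak g^\vee[-2]$. Its fields are $$\mathcal E=\big(\Omega^*_{S^1}\otimes\mathfrak g[1]\big)\oplus\big(\Omega^*_{S^1}\otimes\mathfrak g^\vee[-1]\big)\ni \alpha+\beta ,$$ with $Q=d$ (together with the differential of $R$), $Q^*=d^*$, the degree $-1$ symplectic pairing $\langle-,-\rangle$ induced by evaluation and integration over $S^1$, and classical interaction $I_{CS}(\alpha+\beta)=\sum_{n\ge 0}\frac1{n!}\langle\beta,\ell_n(\alpha^{\otimes n})\rangle$. Let $\mathcal O(\mathcal E)=\prod_{n\ge0}\mathrm{Sym}^n(\mathcal E^\vee)$ be the completed symmetric algebra (over $R$) of the continuous dual of $\mathcal E$, let $K_t$ be the heat kernel of $[Q,Q^*]$ and $P_\epsilon^L=\int_\epsilon^L(Q^*\otimes1)K_t\,dt$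 the propagator. A quantization is a family $I[L]=\sum_{i\ge0}\hbar^iI^{(i)}[L]\in\mathcal O(\mathcal E)[[\hbar]]$, $L>0$, of cohomological degree $0$ such that: (1) $I[L]=W(P_\epsilon^L,I[\epsilon])$ for $0<\epsilon<L$, where $W(P,I)=\sum_\gamma\frac{\hbar^{g(\gamma)}}{|\mathrm{Aut}\,\gamma|}W_\gamma(P,I)$ is the sum over connected Feynman graphs; (2) each homogeneous component of each $I^{(i)}[L]$ has a small-$L$ asymptotic expansion, in the weak topology, into local functionals with coefficients that are smooth functions of $L\in(0,\infty)$; (3) $QI[L]+\hbar\Delta_LI[L]+\tfrac12\{I[L],I[L]\}_L=0$ for all $L>0$, where $\Delta_L$ is contraction with $K_L$ and $\{-,-\}_L$ is the associated bracket; (4) $\lim_{L\to0}I^{(0)}[L]=I_{CS}$. Let $z\in\mathbb G_m=k^\times$ act on $\mathcal E$ by $z\cdot(\alpha+\beta)=\alpha+z^{-1}\beta$, on $\mathcal O(\mathcal E)$ by $(\mu(z)F)(\phi)=F(z^{-1}\cdot\phi)$, and on $\mathcal O(\mathcal E)[[\hbar]]$ by giving $\hbar$ weight one: $\mu(z)\big(\sum_i\hbar^iF_i\big)=\sum_i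 z^i\hbar^i\mu(z)F_i$. A quantization is $\mathbb G_m$-invariant if every $I[L]$ has weight one, i.e. $\mu(z)I[L]=z\,I[L]$ for all $z$. **Proposition.** If $\{I[L]\}$ is a $\mathbb G_m$-invariant quantization of one-dimensional Chern--Simons theory on $S^1$, then for every $L>0$ one has $I^{(i)}[L]=0$ for all $i>1$, and $I^{(1)}[L]$ lies in the subspace $\mathcal O(\Omega^*_{S^1}\otimes\mathfrak g[1])\subset\mathcal O(\mathcal E)$ of functionals that depend only on $\alpha$ (embedded by pullback along the projection $\alpha+\beta\mapsto\alpha$). -/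

import Mathlib

open scoped ContDiff Topology BigOperators

noncomputable section

namespace OneDimCS

/-! ### Signs, and cochains on a graded set of generators -/

/-- The sign `(-1)^n`. -/
def sgn (n : ℤ) : ℤ := if Even n then 1 else -1

/-- Families of functions of `n` generators (`n ≥ 0`) with values in `R`. A power series `F` on a
graded vector space spanned by `X` is recorded by the polarizations `F n` of its homogeneous
components: the degree `n` part of `F` at `φ` is `F n (φ, …, φ) / n!`. -/
abbrev Cochain (X R : Type*) : Type _ := ∀ n : ℕ, (Fin n → X) → R

/-- The base: a topological commutative dga `(R, d)`, graded by `𝒜`, with a nilpotent ideal. -/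
structure DGBase (𝕜 : Type*) [RCLike 𝕜] (R : Type*) [Ring R] [Algebra 𝕜 R] [TopologicalSpace R]
    (𝒜 : ℤ → Submodule 𝕜 R) [GradedAlgebra 𝒜] where
  /-- graded commutativity -/
  comm : ∀ i j : ℤ, ∀ a ∈ 𝒜 i, ∀ b ∈ 𝒜 j, a * b = sgn (i * j) • (b * a)
  /-- the differential -/
  d : R →L[𝕜] R
  d_mem : ∀ i : ℤ, ∀ a ∈ 𝒜 i, d a ∈ 𝒜 (i + 1)
  d_d : ∀ a, d (d a) = 0
  d_mul : ∀ i : ℤ, ∀ a ∈ 𝒜 i, ∀ b, d (a * b) = d a * b + sgn i • (a * d b)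
  /-- the nilpotent ideal -/
  J : TwoSidedIdeal R
  J_nilpotent : ∃ N : ℕ, ∀ a : Fin N → R, (∀ i, a i ∈ J) → (List.ofFn a).prod = 0

section Cochains

variable {𝕜 : Type*} [RCLike 𝕜] {R : Type*} [Ring R] [Algebra 𝕜 R]
  (𝒜 : ℤ → Submodule 𝕜 R) [GradedAlgebra 𝒜] {X : Type*} (deg : X → ℤ)

/-- The parity involution of `R`, equal to `(-1)^i` on the degree `i` part. -/
def parity : R →ₗ[𝕜] R :=
  (DirectSum.toModule 𝕜 ℤ R fun i => sgn i • (𝒜 i).subtype) ∘ₗ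
    (DirectSum.decomposeLinearEquiv 𝒜).toLinearMap

/-- `F` has degree `p`: as a map to `R` it raises degrees by `p`. -/
def HasDegree (p : ℤ) (F : Cochain X R) : Prop :=
  ∀ n (x : Fin n → X), F n x ∈ 𝒜 (p + ∑ i, deg (x i))

/-- `par F = (-1)^p F` when `F` has degree `p`. -/
def par (F : Cochain X R) : Cochain X R :=
  fun n x => sgn (∑ i, deg (x i)) • parity 𝒜 (F n x)

/-- `(-1)^(p m) F` when `F` has degree `p`. -/
def parPow (m : ℤ) (F : Cochain X R) : Cochain X R := if Even m then F else par 𝒜 deg F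

/-- The Koszul sign of moving the entries of `x` in the positions `S` in front of the others. -/
def shuffleSign {n : ℕ} (x : Fin n → X) (S : Finset (Fin n)) : ℤ :=
  ∏ i ∈ Sᶜ, ∏ j ∈ S, if i < j then sgn (deg (x i) * deg (x j)) else 1

/-- The product of power series, in terms of polarizations: the sum over shuffles. -/
def mul (F G : Cochain X R) : Cochain X R := fun n x =>
  ∑ S : Finset (Fin n), shuffleSign deg x S •
    (F S.card (fun i => x (S.orderEmbOfFin rfl i)) *
      parPow 𝒜 deg (∑ i ∈ S, deg (x i)) G Sᶜ.card (fun i => x (Sᶜ.orderEmbOfFin rfl i)))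

end Cochains

/-! ### Curved `L_∞` algebras -/

section LInfinity

/-- The completed symmetric algebra `Sym^(𝔤^∨[-1])` over `R`, for `𝔤` free of finite rank with
homogeneous basis `e_a` of degree `dg a`: graded symmetric cochains on the basis of `𝔤[1]`. -/
def CE (𝕜 : Type*) [RCLike 𝕜] (R : Type*) [Ring R] [Algebra 𝕜 R] {ι : Type*} (dg : ι → ℤ) :
    Submodule 𝕜 (Cochain ι R) where
  carrier := {F | ∀ (n : ℕ) (a : Fin n → ι) (i j : Fin n), (i : ℕ) + 1 = j →
    F n (a ∘ Equiv.swap i j) = sgn ((dg (a i) - 1) * (dg (a j) - 1)) • F n a}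
  add_mem' := by
    intro F G hF hG n a i j hij
    simp only [Pi.add_apply, hF n a i j hij, hG n a i j hij, smul_add]
  zero_mem' := by intro n a i j _; simp
  smul_mem' := by
    intro c F hF n a i j hij
    simp only [Pi.smul_apply, hF n a i j hij]
    rw [smul_comm]

/-- The constant power series `r`. -/
def const {X R : Type*} [Ring R] (r : R) : Cochain X R := fun n _ => if n = 0 then r else 0

/-- The coordinate function `x^b` on `𝔤[1]` dual to the basis vector `e_b`. -/
def coord (𝕜 : Type*) [RCLike 𝕜] (R : Type*) [Ring R] [Algebra 𝕜 R] {ι : Type*} [DecidableEq ι]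
    (dg : ι → ℤ) (b : ι) : CE 𝕜 R dg :=
  ⟨fun n a => if h : n = 1 then (if a ⟨0, by omega⟩ = b then 1 else 0) else 0, by
    intro n a i j hij
    have h : n ≠ 1 := by
      rintro rfl
      have := i.2; have := j.2; omega
    simp [h]⟩

/-- A curved `L_∞` structure over the commutative dga `R` on the free graded module `𝔤` with
homogeneous basis `e_a`, `a ∈ ι`, of degrees `dg a`: a square-zero derivation of degree one of
`Sym^(𝔤^∨[-1])` that makes it a dga over `R` and that, modulo the nilpotent ideal, preserves the
ideal generated by `𝔤^∨[-1]`. -/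
structure CurvedLInfinity {𝕜 : Type*} [RCLike 𝕜] {R : Type*} [Ring R] [Algebra 𝕜 R]
    [TopologicalSpace R] {𝒜 : ℤ → Submodule 𝕜 R} [GradedAlgebra 𝒜] (B : DGBase 𝕜 R 𝒜)
    {ι : Type*} (dg : ι → ℤ) where
  d : CE 𝕜 R dg →ₗ[𝕜] CE 𝕜 R dg
  d_degree : ∀ (p : ℤ) (F : CE 𝕜 R dg), HasDegree 𝒜 (fun a => dg a - 1) p F.1 →
    HasDegree 𝒜 (fun a => dg a - 1) (p + 1) (d F).1
  d_mul : ∀ F G H : CE 𝕜 R dg, H.1 = mul 𝒜 (fun a => dg a - 1) F.1 G.1 →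
    (d H).1 = mul 𝒜 (fun a => dg a - 1) (d F).1 G.1 +
      mul 𝒜 (fun a => dg a - 1) (par 𝒜 (fun a => dg a - 1) F.1) (d G).1
  d_const : ∀ (r : R) (F : CE 𝕜 R dg), F.1 = const r → (d F).1 = const (B.d r)
  d_d : ∀ F, d (d F) = 0
  curving : ∀ F : CE 𝕜 R dg, F.1 0 Fin.elim0 = 0 → (d F).1 0 Fin.elim0 ∈ B.J

/-- The coefficient of `e_b` in the bracket `ℓ_n(e_{a_1}, …, e_{a_n})`, where the bracket is viewed
as a graded symmetric operation of degree one on `𝔤[1]`: the dual of the component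
`𝔤^∨[-1] → Sym^n(𝔤^∨[-1])` of the derivation. -/
def CurvedLInfinity.bracket {𝕜 : Type*} [RCLike 𝕜] {R : Type*} [Ring R] [Algebra 𝕜 R]
    [TopologicalSpace R] {𝒜 : ℤ → Submodule 𝕜 R} [GradedAlgebra 𝒜] {B : DGBase 𝕜 R 𝒜}
    {ι : Type*} [DecidableEq ι] {dg : ι → ℤ} (g : CurvedLInfinity B dg)
    (n : ℕ) (b : ι) (a : Fin n → ι) : R :=
  (g.d (coord 𝕜 R dg b)).1 n a

end LInfinity

/-! ### Smooth functions on the circle -/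

section Circle

variable (𝕜 : Type*) [RCLike 𝕜] (ℓ : ℝ)

/-- Smooth `𝕜`-valued functions on `S¹ = ℝ/ℓℤ`, as a space of periodic functions. -/
def smoothPeriodic : Submodule 𝕜 (ℝ → 𝕜) where
  carrier := {f | ContDiff ℝ ∞ f ∧ Function.Periodic f ℓ}
  add_mem' := fun hf hg => ⟨hf.1.add hg.1, hf.2.add hg.2⟩
  zero_mem' := ⟨contDiff_const, fun _ => rfl⟩
  smul_mem' := fun c _ hf => ⟨hf.1.const_smul c, fun x => by simp [hf.2 x]⟩

/-- The space `C^∞(S¹)`. -/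
def SmoothCircle : Type _ := smoothPeriodic 𝕜 ℓ

instance : AddCommGroup (SmoothCircle 𝕜 ℓ) := inferInstanceAs (AddCommGroup (smoothPeriodic 𝕜 ℓ))

instance : Module 𝕜 (SmoothCircle 𝕜 ℓ) := inferInstanceAs (Module 𝕜 (smoothPeriodic 𝕜 ℓ))

variable {𝕜 ℓ}

/-- The periodic function underlying an element of `C^∞(S¹)`. -/
def SmoothCircle.fn (f : SmoothCircle 𝕜 ℓ) : ℝ → 𝕜 := f.1

/-- The Fréchet topology: uniform convergence of all derivatives. -/
instance : TopologicalSpace (SmoothCircle 𝕜 ℓ) :=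
  ⨅ n : ℕ, TopologicalSpace.induced
    (fun f : SmoothCircle 𝕜 ℓ => UniformFun.ofFun (iteratedDeriv n f.fn)) inferInstance

instance : ContinuousConstSMul 𝕜 (SmoothCircle 𝕜 ℓ) where
  continuous_const_smul c := by
    refine continuous_iInf_rng.2 fun n => continuous_induced_rng.2 ?_
    have h1 : Continuous (fun f : SmoothCircle 𝕜 ℓ =>
        UniformFun.ofFun (iteratedDeriv n f.fn)) :=
      continuous_iInf_dom (i := n) continuous_induced_dom
    have h2 : ((fun f : SmoothCircle 𝕜 ℓ => UniformFun.ofFun (iteratedDeriv n f.fn)) ∘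
        fun f => c • f) = fun f : SmoothCircle 𝕜 ℓ =>
          c • UniformFun.ofFun (iteratedDeriv n f.fn) := by
      funext f
      have h3 : (c • f).fn = c • f.fn := rfl
      have h4 : ContDiff ℝ n f.fn := f.2.1.of_le (by exact_mod_cast le_top)
      have h5 : iteratedDeriv n (c • f.fn) = c • iteratedDeriv n f.fn := by
        funext x
        exact iteratedDeriv_const_smul h4.contDiffAt c
      simp only [Function.comp_apply, h3, h5]
      rfl
    rw [h2]
    exact h1.const_smul c

/-- The derivative on `C^∞(S¹)`. -/
def SmoothCircle.deriv (f : SmoothCircle 𝕜 ℓ) : SmoothCircle 𝕜 ℓ :=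
  ⟨_root_.deriv f.fn, (contDiff_infty_iff_deriv.1 f.2.1).2, fun x => by
    have h : (fun y => f.fn (y + ℓ)) = f.fn := funext f.2.2
    rw [← deriv_comp_add_const, h]⟩

variable (𝕜 ℓ)

/-- The functions `cos (2πnx/ℓ)` and `sin (2πnx/ℓ)`. -/
def fourierMode (n : ℤ) (c : Bool) : SmoothCircle 𝕜 ℓ :=
  ⟨fun x => RCLike.ofReal (bif c then Real.cos (2 * Real.pi * n * x / ℓ)
      else Real.sin (2 * Real.pi * n * x / ℓ)), by
    constructor
    · refine (RCLike.ofRealCLM : ℝ →L[ℝ] 𝕜).contDiff.comp ?_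
      cases c <;> simp only [cond_true, cond_false] <;> fun_prop
    · intro x
      rcases eq_or_ne ℓ 0 with h | h
      · simp [h]
      · have e : 2 * Real.pi * n * (x + ℓ) / ℓ = 2 * Real.pi * n * x / ℓ + n * (2 * Real.pi) := by
          field_simp
        cases c <;> simp [e, Real.cos_add_int_mul_two_pi, Real.sin_add_int_mul_two_pi]⟩

end Circle

/-! ### Functionals on spaces of fields -/

section Functionals

variable {𝕜 : Type*} [RCLike 𝕜] {ℓ : ℝ} (R : Type*) [Ring R] [Algebra 𝕜 R]
  [TopologicalSpace R] [IsTopologicalRing R] [ContinuousSMul 𝕜 R]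

/-- Fields with components `C`: sections of the trivial graded bundle over `S¹` with a frame
indexed by `C`. -/
abbrev Fields (𝕜 : Type*) [RCLike 𝕜] (ℓ : ℝ) (C : Type*) : Type _ := C → SmoothCircle 𝕜 ℓ

/-- `φ` is homogeneous of degree `p`, where the frame vector `c` has degree `deg c`. -/
def IsHomogeneousField {C : Type*} (deg : C → ℤ) (p : ℤ) (φ : Fields 𝕜 ℓ C) : Prop :=
  ∀ c, deg c ≠ p → φ c = 0

/-- `Sym^k(ℰ^∨)`, `ℰ^∨` the continuous dual, with coefficients in `R`: continuous graded symmetric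
`k`-linear functionals of the fields. -/
def SymPow (𝕜 : Type*) [RCLike 𝕜] (ℓ : ℝ) (R : Type*) [Ring R] [Algebra 𝕜 R]
    [TopologicalSpace R] [IsTopologicalRing R] [ContinuousSMul 𝕜 R]
    {C : Type*} (deg : C → ℤ) (k : ℕ) :
    Submodule 𝕜 (ContinuousMultilinearMap 𝕜 (fun _ : Fin k => Fields 𝕜 ℓ C) R) where
  carrier := {T | ∀ (p : Fin k → ℤ) (φ : Fin k → Fields 𝕜 ℓ C),
    (∀ i, IsHomogeneousField deg (p i) (φ i)) → ∀ i j : Fin k, (i : ℕ) + 1 = j →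
      T (φ ∘ Equiv.swap i j) = sgn (p i * p j) • T φ}
  add_mem' := by
    intro S T hS hT p φ h i j hij
    simp only [ContinuousMultilinearMap.add_apply, hS p φ h i j hij, hT p φ h i j hij, smul_add]
  zero_mem' := by intro p φ _ i j _; simp
  smul_mem' := by
    intro c T hT p φ h i j hij
    simp only [ContinuousMultilinearMap.smul_apply, hT p φ h i j hij]
    rw [smul_comm]

/-- `𝒪(ℰ)`, the completed symmetric algebra of `ℰ^∨`: the product of all `Sym^k(ℰ^∨)`. -/
abbrev Functionals (𝕜 : Type*) [RCLike 𝕜] (ℓ : ℝ) (R : Type*) [Ring R] [Algebra 𝕜 R]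
    [TopologicalSpace R] [IsTopologicalRing R] [ContinuousSMul 𝕜 R]
    {C : Type*} (deg : C → ℤ) : Type _ := ∀ k : ℕ, SymPow 𝕜 ℓ R deg k

/-- `𝒪(ℰ)[[ħ]]`: the coefficient of `ħ^i` is the value at `i`. -/
abbrev HFunctionals (𝕜 : Type*) [RCLike 𝕜] (ℓ : ℝ) (R : Type*) [Ring R] [Algebra 𝕜 R]
    [TopologicalSpace R] [IsTopologicalRing R] [ContinuousSMul 𝕜 R]
    {C : Type*} (deg : C → ℤ) : Type _ := ℕ → Functionals 𝕜 ℓ R deg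

variable {R} {C C' : Type*}

/-- Pullback of functionals along a continuous linear map that preserves degrees. -/
def pullback {deg : C → ℤ} {deg' : C' → ℤ} (A : Fields 𝕜 ℓ C →L[𝕜] Fields 𝕜 ℓ C')
    (hA : ∀ p φ, IsHomogeneousField deg p φ → IsHomogeneousField deg' p (A φ))
    (F : Functionals 𝕜 ℓ R deg') : Functionals 𝕜 ℓ R deg := fun k =>
  ⟨(F k).1.compContinuousLinearMap fun _ => A, by
    intro p φ h i j hij
    exact (F k).2 p (fun i => A (φ i)) (fun i => hA _ _ (h i)) i j hij⟩

end Functionals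

/-! ### The fields of one-dimensional Chern–Simons theory -/

/-- Frame of `Λ^*T^*S¹ ⊗ (𝔤[1] ⊕ 𝔤^∨[-1])`: the pair `(s, inl a)` stands for `(dx)^s ⊗ e_a` and
`(s, inr a)` for `(dx)^s ⊗ e^a`, where `s = true` is read as exponent one, and where `e_a` is a
homogeneous basis of `𝔤` and `e^a` its dual basis. -/
abbrev Idx (ι : Type*) : Type _ := Bool × (ι ⊕ ι)

section Theory

variable {ι : Type*} (dg : ι → ℤ)

/-- The form degree. -/
def fdeg (s : Bool) : ℤ := if s then 1 else 0

/-- Degrees in `Ω^*(S¹) ⊗ (𝔤[1] ⊕ 𝔤^∨[-1])`. -/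
def fieldDeg (c : Idx ι) : ℤ :=
  fdeg c.1 + Sum.elim (fun a => dg a - 1) (fun a => 1 - dg a) c.2

/-- Degrees in `Ω^*(S¹) ⊗ 𝔤[1]`, with frame `(s, a) = (dx)^s ⊗ e_a`. -/
def alphaDeg (c : Bool × ι) : ℤ := fdeg c.1 + (dg c.2 - 1)

/-- The frame vector dual to `c` under the pairing. -/
def dualIdx (c : Idx ι) : Idx ι := (!c.1, c.2.swap)

variable [DecidableEq ι]

/-- The fibrewise symplectic pairing of frame vectors (the coefficient of `dx`), of degree `-1`:
it is antisymmetric and `⟨η ⊗ λ, θ ⊗ X⟩ = (-1)^{|λ||θ|} η ∧ θ λ(X)` for `λ ∈ 𝔤^∨[-1]`,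
`X ∈ 𝔤[1]`. -/
def pairing : Idx ι → Idx ι → ℤ
  | (s, .inr a), (t, .inl b) => if a = b ∧ s ≠ t then sgn ((1 - dg a) * fdeg t) else 0
  | (t, .inl b), (s, .inr a) => if a = b ∧ s ≠ t then -sgn ((1 - dg a) * fdeg t) else 0
  | _, _ => 0

variable (𝕜 : Type*) [RCLike 𝕜] (ℓ : ℝ)

/-- Generators of the space of fields: `(c, f)` is the field `f · c` with `c` a frame vector. -/
abbrev Gen (𝕜 : Type*) [RCLike 𝕜] (ℓ : ℝ) (ι : Type*) : Type _ := Idx ι × SmoothCircle 𝕜 ℓ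

/-- The degree of a generator. -/
def genDeg (x : Gen 𝕜 ℓ ι) : ℤ := fieldDeg dg x.1

variable {𝕜 ℓ}

/-- The exterior derivative on generators, `Q = d`. -/
def extD (x : Gen 𝕜 ℓ ι) : Gen 𝕜 ℓ ι :=
  if x.1.1 then (x.1, 0) else ((true, x.1.2), x.2.deriv)

/-- Its formal adjoint on generators, `Q^* = d^*`. -/
def extDStar (x : Gen 𝕜 ℓ ι) : Gen 𝕜 ℓ ι :=
  if x.1.1 then ((false, x.1.2), -x.2.deriv) else (x.1, 0)

/-- An element of the completed tensor square of the fields written as a series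
`∑_ν coeff ν • fst ν ⊗ snd ν` of tensors of generators. -/
structure Kernel (N : Type*) (𝕜 : Type*) [RCLike 𝕜] (ℓ : ℝ) (ι : Type*) where
  coeff : N → 𝕜
  fst : N → Gen 𝕜 ℓ ι
  snd : N → Gen 𝕜 ℓ ι

/-- Labels of the terms of the heat kernel: a Fourier mode and a frame vector. -/
abbrev Mode (ι : Type*) : Type _ := (ℤ × Bool) × Idx ι

variable (𝕜 ℓ)

/-- The heat kernel `K_t` of `D = [d, d^*]` on `ℝ/ℓℤ`, as its eigenfunction expansion:
the scalar kernel is `ℓ⁻¹ ∑_{n ∈ ℤ} e^{-t(2πn/ℓ)²} cos (2πn(x - y)/ℓ)`. The coefficient of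
`c ⊗ dualIdx c` makes `K_t` a graded symmetric element of degree one with
`∫_y (1 ⊗ ⟨-,-⟩)(K_t ⊗ φ) = e^{-tD} φ`, where the pairing, being of degree `-1`, passes the first
leg with its Koszul sign. -/
def heatKernel (t : ℝ) : Kernel (Mode ι) 𝕜 ℓ ι where
  coeff ν := ((ℓ⁻¹ * Real.exp (-t * (2 * Real.pi * ν.1.1 / ℓ) ^ 2) : ℝ) : 𝕜) *
    ((sgn (fieldDeg dg ν.2) * pairing dg (dualIdx ν.2) ν.2 : ℤ) : 𝕜)
  fst ν := (ν.2, fourierMode 𝕜 ℓ ν.1.1 ν.1.2)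
  snd ν := (dualIdx ν.2, fourierMode 𝕜 ℓ ν.1.1 ν.1.2)

/-- The propagator `P_ε^L = ∫_ε^L (Q^* ⊗ 1) K_t dt`. -/
def propagator (ε L : ℝ) : Kernel (Mode ι) 𝕜 ℓ ι where
  coeff ν := ∫ t in ε..L, (heatKernel dg 𝕜 ℓ t).coeff ν
  fst ν := extDStar ((heatKernel dg 𝕜 ℓ 0).fst ν)
  snd ν := (heatKernel dg 𝕜 ℓ 0).snd ν

end Theory

/-! ### Feynman graphs and the renormalization group flow -/

/-- A finite graph with vertices, half-edges, and an internal genus at each vertex. The fixed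
points of the involution are the tails, its other orbits are the (internal) edges. -/
structure FeynmanGraph where
  v : ℕ
  m : ℕ
  at_ : Fin m → Fin v
  inv : Fin m → Fin m
  inv_inv : ∀ h, inv (inv h) = h
  genus : Fin v → ℕ

namespace FeynmanGraph

/-- Isomorphisms of graphs. -/
structure Iso (Γ Γ' : FeynmanGraph) where
  vert : Fin Γ.v ≃ Fin Γ'.v
  half : Fin Γ.m ≃ Fin Γ'.m
  at_comm : ∀ h, Γ'.at_ (half h) = vert (Γ.at_ h)
  inv_comm : ∀ h, Γ'.inv (half h) = half (Γ.inv h)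
  genus_comm : ∀ w, Γ'.genus (vert w) = Γ.genus w

instance setoid : Setoid FeynmanGraph where
  r Γ Γ' := Nonempty (Iso Γ Γ')
  iseqv :=
    { refl := fun Γ => ⟨⟨Equiv.refl _, Equiv.refl _, fun _ => rfl, fun _ => rfl, fun _ => rfl⟩⟩
      symm := by
        rintro Γ Γ' ⟨e⟩
        refine ⟨⟨e.vert.symm, e.half.symm, fun h => ?_, fun h => ?_, fun w => ?_⟩⟩
        · rw [Equiv.eq_symm_apply, ← e.at_comm, Equiv.apply_symm_apply]
        · rw [Equiv.eq_symm_apply, ← e.inv_comm, Equiv.apply_symm_apply]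
        · rw [← e.genus_comm, Equiv.apply_symm_apply]
      trans := by
        rintro Γ Γ' Γ'' ⟨e⟩ ⟨f⟩
        refine ⟨⟨e.vert.trans f.vert, e.half.trans f.half, fun h => ?_, fun h => ?_, fun w => ?_⟩⟩
        · simp [f.at_comm, e.at_comm]
        · simp [f.inv_comm, e.inv_comm]
        · simp [f.genus_comm, e.genus_comm] }

/-- Isomorphism classes of graphs. -/
abbrev Class : Type := Quotient FeynmanGraph.setoid

variable (Γ : FeynmanGraph)

/-- Half-edges that are tails. -/
abbrev Tail : Type := {h : Fin Γ.m // Γ.inv h = h}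

/-- Edges, represented by the smaller of their two half-edges. -/
abbrev Edge : Type := {h : Fin Γ.m // h < Γ.inv h}

/-- Connectedness (in particular there is at least one vertex). -/
def IsConnected : Prop :=
  (SimpleGraph.fromRel fun a b : Fin Γ.v => ∃ h, Γ.at_ h = a ∧ Γ.at_ (Γ.inv h) = b).Connected

/-- The total genus is `i`: the first Betti number, which is the number of edges minus the number
of vertices plus one, plus the genera of the vertices. -/
def HasGenus (i : ℕ) : Prop := i + Γ.v = Fintype.card Γ.Edge + 1 + ∑ w, Γ.genus w

variable {𝕜 : Type*} [RCLike 𝕜] {ℓ : ℝ} {ι : Type*} {N : Type*}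

/-- The generators at the half-edges when the `k` tails are fed with `x`, in the order given by
`τ`, and the edge `e` carries the term `ν e` of the kernel `P`. -/
def label (P : Kernel N 𝕜 ℓ ι) {k : ℕ} (x : Fin k → Gen 𝕜 ℓ ι) (τ : Fin k ≃ Γ.Tail)
    (ν : Γ.Edge → N) (h : Fin Γ.m) : Gen 𝕜 ℓ ι :=
  if ht : Γ.inv h = h then x (τ.symm ⟨h, ht⟩)
  else if hl : h < Γ.inv h then P.fst (ν ⟨h, hl⟩)
  else P.snd (ν ⟨Γ.inv h, by
    rw [Γ.inv_inv]; exact lt_of_le_of_ne (not_lt.1 hl) ht⟩)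

/-- Position of a half-edge in the order: both ends of each edge, then the tails as in `x`. -/
def sourcePos {k : ℕ} (τ : Fin k ≃ Γ.Tail) (h : Fin Γ.m) : ℕ :=
  if ht : Γ.inv h = h then 2 * Γ.m + τ.symm ⟨h, ht⟩
  else if h < Γ.inv h then 2 * h else 2 * Γ.inv h + 1

/-- Position of a half-edge in the order by vertices. -/
def targetPos (h : Fin Γ.m) : ℕ := Γ.at_ h * Γ.m + h

/-- The Koszul sign of reordering the half-edges from the first order to the second. -/
def koszulSign (dg : ι → ℤ) {k : ℕ} (τ : Fin k ≃ Γ.Tail) (y : Fin Γ.m → Gen 𝕜 ℓ ι) : ℤ :=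
  ∏ h, ∏ h', if Γ.sourcePos τ h < Γ.sourcePos τ h' ∧ Γ.targetPos h' < Γ.targetPos h then
    sgn (genDeg dg 𝕜 ℓ (y h) * genDeg dg 𝕜 ℓ (y h')) else 1

variable {R : Type*} [Ring R] [Algebra 𝕜 R] [TopologicalSpace R]

/-- The product over the vertices `w`, in order, of the component `I_{i,j}` of `I`, with `i` the
genus and `j` the valence of `w`, evaluated on the generators at the half-edges at `w`. -/
def vertexProduct (I : ℕ → Cochain (Gen 𝕜 ℓ ι) R) (y : Fin Γ.m → Gen 𝕜 ℓ ι) : R :=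
  (List.ofFn fun w : Fin Γ.v =>
    I (Γ.genus w) (Finset.univ.filter fun h => Γ.at_ h = w).card
      (fun i => y ((Finset.univ.filter fun h => Γ.at_ h = w).orderEmbOfFin rfl i))).prod

/-- The weight `W_Γ(P, I)`, polarized, evaluated on `x` (zero unless `Γ` has `k` tails). -/
def weight (dg : ι → ℤ) (P : Kernel N 𝕜 ℓ ι) (I : ℕ → Cochain (Gen 𝕜 ℓ ι) R)
    {k : ℕ} (x : Fin k → Gen 𝕜 ℓ ι) : R :=
  ∑ τ : Fin k ≃ Γ.Tail, ∑' ν : Γ.Edge → N, (∏ e, P.coeff (ν e)) •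
    (Γ.koszulSign dg τ (Γ.label P x τ ν) • Γ.vertexProduct I (Γ.label P x τ ν))

open Classical in
/-- The contribution of `Γ` to the coefficient of `ħ^i` of the renormalization group flow. -/
def contribution (dg : ι → ℤ) (P : Kernel N 𝕜 ℓ ι) (I : ℕ → Cochain (Gen 𝕜 ℓ ι) R)
    (i : ℕ) {k : ℕ} (x : Fin k → Gen 𝕜 ℓ ι) : R :=
  if Γ.IsConnected ∧ Γ.HasGenus i then
    ((Nat.card (Iso Γ Γ) : 𝕜)⁻¹) • Γ.weight dg P I x else 0

end FeynmanGraph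

/-! ### Quantizations -/

section Quantization

variable {𝕜 : Type*} [RCLike 𝕜] {ℓ : ℝ} {R : Type*} [Ring R] [Algebra 𝕜 R] [TopologicalSpace R]
  [IsTopologicalRing R] [ContinuousSMul 𝕜 R] {𝒜 : ℤ → Submodule 𝕜 R} [GradedAlgebra 𝒜]
  {ι : Type*} [DecidableEq ι]

/-- The values of a functional on generators. -/
def toCochain {dg : ι → ℤ} (F : Functionals 𝕜 ℓ R (fieldDeg dg)) : Cochain (Gen 𝕜 ℓ ι) R :=
  fun n x => (F n).1 fun i => Pi.single (x i).1 (x i).2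

/-- The renormalization group flow equation `J = W(P, I)`, where
`W(P, I) = ∑_Γ ħ^{g(Γ)} / |Aut Γ| W_Γ(P, I)` over connected graphs. When `I` is at least cubic
modulo `ħ` and has no constant term at order `ħ`, only stable graphs contribute; in general it is
part of the condition that finitely many graphs contribute to each value. -/
def IsRGFlow {N : Type*} (dg : ι → ℤ) (P : Kernel N 𝕜 ℓ ι)
    (I J : ℕ → Cochain (Gen 𝕜 ℓ ι) R) : Prop :=
  ∀ (i k : ℕ) (x : Fin k → Gen 𝕜 ℓ ι),
    {Γ : FeynmanGraph.Class | Γ.out.contribution dg P I i x ≠ 0}.Finite ∧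
    J i k x = ∑ᶠ Γ : FeynmanGraph.Class, Γ.out.contribution dg P I i x

/-- The differential on functionals induced by `Q = d` on the fields and by the differential of
`R`: `(QF)(x) = d_R (F x) - (-1)^{|F|} F(dx)`. -/
def diffQ (B : DGBase 𝕜 R 𝒜) (dg : ι → ℤ) (F : Cochain (Gen 𝕜 ℓ ι) R) :
    Cochain (Gen 𝕜 ℓ ι) R := fun n x =>
  B.d (F n x) - ∑ i : Fin n, sgn (∑ j ∈ Finset.univ.filter (· < i), genDeg dg 𝕜 ℓ (x j)) •
    par 𝒜 (genDeg dg 𝕜 ℓ) F n (Function.update x i (extD (x i)))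

variable (𝒜)

/-- The BV Laplacian `Δ_L`: contraction with the symmetric tensor `K_L`. -/
def bvLaplacian (dg : ι → ℤ) (L : ℝ) (F : Cochain (Gen 𝕜 ℓ ι) R) : Cochain (Gen 𝕜 ℓ ι) R :=
  fun n x => (2⁻¹ : 𝕜) • ∑' ν : Mode ι, (heatKernel dg 𝕜 ℓ L).coeff ν •
    par 𝒜 (genDeg dg 𝕜 ℓ) F (n + 2)
      (Fin.cons ((heatKernel dg 𝕜 ℓ L).fst ν) (Fin.cons ((heatKernel dg 𝕜 ℓ L).snd ν) x))

/-- The BV bracket `{F, G}_L = Δ_L(FG) - (Δ_L F)G - (-1)^{|F|} F Δ_L G`. -/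
def bvBracket (dg : ι → ℤ) (L : ℝ) (F G : Cochain (Gen 𝕜 ℓ ι) R) : Cochain (Gen 𝕜 ℓ ι) R :=
  bvLaplacian 𝒜 dg L (mul 𝒜 (genDeg dg 𝕜 ℓ) F G)
    - mul 𝒜 (genDeg dg 𝕜 ℓ) (bvLaplacian 𝒜 dg L F) G
    - mul 𝒜 (genDeg dg 𝕜 ℓ) (par 𝒜 (genDeg dg 𝕜 ℓ) F) (bvLaplacian 𝒜 dg L G)

variable {𝒜}

/-- The scale `L` quantum master equation `Q I + ħ Δ_L I + ½ {I, I}_L = 0`, order by order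
in `ħ`. -/
def SatisfiesQME (B : DGBase 𝕜 R 𝒜) (dg : ι → ℤ) (L : ℝ)
    (I : ℕ → Cochain (Gen 𝕜 ℓ ι) R) : Prop :=
  ∀ i : ℕ, diffQ B dg (I i)
    + (if i = 0 then 0 else bvLaplacian 𝒜 dg L (I (i - 1)))
    + (2⁻¹ : 𝕜) • ∑ a ∈ Finset.range (i + 1), bvBracket 𝒜 dg L (I a) (I (i - a)) = 0

/-- A `k`-linear functional is local: it is a finite sum of terms
`∫_{S¹} (D_1 φ_1) ⋯ (D_k φ_k) h dx` with `D_j` a power of `d/dx` applied to a component of the field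
and `h` a smooth `R`-valued density, integrals and smoothness being understood weakly. -/
def IsLocal {C : Type*} {k : ℕ}
    (T : ContinuousMultilinearMap 𝕜 (fun _ : Fin k => Fields 𝕜 ℓ C) R) : Prop :=
  ∃ (s : ℕ) (h : Fin s → ℝ → R) (c : Fin s → Fin k → C) (e : Fin s → Fin k → ℕ),
    (∀ a, Function.Periodic (h a) ℓ) ∧
    (∀ (ψ : R →L[𝕜] 𝕜) a, ContDiff ℝ ∞ fun x => ψ (h a x)) ∧
    ∀ (ψ : R →L[𝕜] 𝕜) (φ : Fin k → Fields 𝕜 ℓ C),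
      ψ (T φ) = ∑ a, ∫ x in (0 : ℝ)..ℓ,
        ψ (h a x) * ∏ j, iteratedDeriv (e a j) (φ j (c a j)).fn x

/-- A family `T[L]`, `L > 0`, of `k`-linear functionals has a small `L` asymptotic expansion
`∑_r g_r(L) Υ_r`, in the weak topology, with `g_r` smooth on `(0, ∞)` and `Υ_r` local. -/
def HasLocalExpansion {dg : ι → ℤ} {k : ℕ} (T : ℝ → SymPow 𝕜 ℓ R (fieldDeg dg) k) : Prop :=
  ∃ (g : ℕ → ℝ → 𝕜) (Υ : ℕ → SymPow 𝕜 ℓ R (fieldDeg dg) k) (o : ℕ → ℤ),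
    (∀ r, ContDiffOn ℝ ∞ (g r) (Set.Ioi 0)) ∧ (∀ r, IsLocal (Υ r).1) ∧
    Monotone o ∧ Filter.Tendsto o Filter.atTop Filter.atTop ∧
    ∀ (r : ℕ) (φ : Fin k → Fields 𝕜 ℓ (Idx ι)),
      Filter.Tendsto (fun L : ℝ => ((L ^ (-o r) : ℝ) : 𝕜) •
        ((T L).1 φ - ∑ q ∈ Finset.range (r + 1), g q L • (Υ q).1 φ)) (𝓝[>] 0) (𝓝 0)

/-- The value of `⟨β, ℓ_n(α_1, …, α_n)⟩` on the generators `β ∈ Ω^* ⊗ 𝔤^∨[-1]` and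
`α_i ∈ Ω^* ⊗ 𝔤[1]`, where the brackets are extended to forms with the Koszul signs; it is zero on
generators of other kinds. -/
def pairBracket [Fintype ι] {B : DGBase 𝕜 R 𝒜} {dg : ι → ℤ} (g : CurvedLInfinity B dg) {n : ℕ}
    (β : Gen 𝕜 ℓ ι) (α : Fin n → Gen 𝕜 ℓ ι) : R :=
  ∑ b : ι, ∑ a : Fin n → ι,
    if β.1.2 = .inr b ∧ (∀ i, (α i).1.2 = .inl (a i)) ∧
        fdeg β.1.1 + ∑ i, fdeg (α i).1.1 = 1 then
      (∫ x in (0 : ℝ)..ℓ, β.2.fn x * ∏ i, (α i).2.fn x) •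
        ((pairing dg β.1 (!β.1.1, .inl b) *
          sgn (∑ i, ∑ j ∈ Finset.univ.filter (· < i), fdeg (α i).1.1 * (dg (a j) - 1))) •
            g.bracket n b a)
    else 0

/-- The classical interaction
`I_CS(φ) = ∑_n 1/(n+1)! ⟨φ, ℓ_n(φ, …, φ)⟩ = ∑_n 1/n! ⟨β, ℓ_n(α, …, α)⟩` for `φ = α + β`, where in
the first expression `ℓ_n` are the brackets of `𝔤 ⊕ 𝔤^∨[-2]`; polarized. -/
def interactionCS [Fintype ι] {B : DGBase 𝕜 R 𝒜} {dg : ι → ℤ} (g : CurvedLInfinity B dg) :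
    Cochain (Gen 𝕜 ℓ ι) R
  | 0, _ => 0
  | _ + 1, x => ∑ p, sgn (genDeg dg 𝕜 ℓ (x p) *
      ∑ j ∈ Finset.univ.filter (· < p), genDeg dg 𝕜 ℓ (x j)) •
        pairBracket g (x p) (p.removeNth x)

/-- A quantization of one-dimensional Chern–Simons theory on `ℝ/ℓℤ` with values in
`𝔤 ⊕ 𝔤^∨[-2]`: a family of effective interactions `I[L]`, `L > 0`. Interactions have cohomological
degree zero. -/
structure IsQuantization [Fintype ι] {B : DGBase 𝕜 R 𝒜} {dg : ι → ℤ} (g : CurvedLInfinity B dg)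
    (I : ℝ → HFunctionals 𝕜 ℓ R (fieldDeg dg)) : Prop where
  degree_zero : ∀ L, 0 < L → ∀ i, HasDegree 𝒜 (genDeg dg 𝕜 ℓ) 0 (toCochain (I L i))
  rge : ∀ ε L, 0 < ε → ε < L → IsRGFlow dg (propagator dg 𝕜 ℓ ε L)
    (fun i => toCochain (I ε i)) (fun i => toCochain (I L i))
  locality : ∀ i k, HasLocalExpansion fun L => I L i k
  qme : ∀ L, 0 < L → SatisfiesQME B dg L fun i => toCochain (I L i)
  classical_limit : ∀ (k : ℕ) (x : Fin k → Gen 𝕜 ℓ ι),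
    Filter.Tendsto (fun L => toCochain (I L 0) k x) (𝓝[>] 0) (𝓝 (interactionCS g k x))

end Quantization

/-! ### The action of the multiplicative group -/

section Action

variable {𝕜 : Type*} [RCLike 𝕜] {ℓ : ℝ} {R : Type*} [Ring R] [Algebra 𝕜 R] [TopologicalSpace R]
  [IsTopologicalRing R] [ContinuousSMul 𝕜 R] {ι : Type*} {dg : ι → ℤ}

/-- The action on fields, `z · (α + β) = α + z⁻¹ β`, for `α ∈ Ω^* ⊗ 𝔤[1]`, `β ∈ Ω^* ⊗ 𝔤^∨[-1]`. -/
def fieldAction (z : 𝕜ˣ) : Fields 𝕜 ℓ (Idx ι) →L[𝕜] Fields 𝕜 ℓ (Idx ι) :=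
  ContinuousLinearMap.pi fun c =>
    (Sum.elim (fun _ => (1 : 𝕜)) (fun _ => ((z⁻¹ : 𝕜ˣ) : 𝕜)) c.2) •
      (ContinuousLinearMap.proj c : Fields 𝕜 ℓ (Idx ι) →L[𝕜] SmoothCircle 𝕜 ℓ)

/-- The action on functionals, `(μ(z) F)(φ) = F(z⁻¹ · φ)`. -/
def mu (z : 𝕜ˣ) (F : Functionals 𝕜 ℓ R (fieldDeg dg)) : Functionals 𝕜 ℓ R (fieldDeg dg) :=
  pullback (fieldAction z⁻¹) (fun p φ h c hc => by
    simp [fieldAction, h c hc]) F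

/-- The action on `𝒪(ℰ)[[ħ]]`, with `ħ` of weight one. -/
def muH (z : 𝕜ˣ) (F : HFunctionals 𝕜 ℓ R (fieldDeg dg)) : HFunctionals 𝕜 ℓ R (fieldDeg dg) :=
  fun i => ((z ^ i : 𝕜ˣ) : 𝕜) • mu z (F i)

/-- `F` has weight `w`. -/
def HasWeight (w : ℤ) (F : HFunctionals 𝕜 ℓ R (fieldDeg dg)) : Prop :=
  ∀ z : 𝕜ˣ, muH z F = ((z ^ w : 𝕜ˣ) : 𝕜) • F

/-- A family of effective interactions is invariant when every `I[L]` has weight one. -/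
def IsGmInvariant (I : ℝ → HFunctionals 𝕜 ℓ R (fieldDeg dg)) : Prop :=
  ∀ L, 0 < L → HasWeight 1 (I L)

/-- The projection `ℰ → Ω^*(S¹) ⊗ 𝔤[1]`. -/
def alphaPart : Fields 𝕜 ℓ (Idx ι) →L[𝕜] Fields 𝕜 ℓ (Bool × ι) :=
  ContinuousLinearMap.pi fun c =>
    (ContinuousLinearMap.proj (c.1, Sum.inl c.2) : Fields 𝕜 ℓ (Idx ι) →L[𝕜] SmoothCircle 𝕜 ℓ)

/-- The inclusion `𝒪(Ω^*(S¹) ⊗ 𝔤[1]) ⊂ 𝒪(ℰ)`. -/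
def inclAlpha (G : Functionals 𝕜 ℓ R (alphaDeg dg)) : Functionals 𝕜 ℓ R (fieldDeg dg) :=
  pullback alphaPart (fun p φ h c hc => by
    have := h (c.1, Sum.inl c.2) (by simpa [fieldDeg, alphaDeg] using hc)
    simpa [alphaPart] using this) G

end Action

end OneDimCS

end

namespace OneDimCS

/-! ### Reduction to fields with a single nonzero component. -/

section Weights

variable {𝕜 : Type*} [RCLike 𝕜] {ℓ : ℝ} {R : Type*} [Ring R] [Algebra 𝕜 R] [TopologicalSpace R]

/-! The result is a count of weights. Evaluate the coefficient of `ħ^i` of a functional on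
single-component fields of which `j` are of type `β`. Acting by `z` multiplies this value by `z^i`,
since `ħ` has weight one, and by a further `z` for each `β`. Weight one therefore gives `z^(i+j) v =
z v` for the value `v`, and already `z = 2` forces `v = 0` unless `i + j = 1`
(`HasWeight.apply_single_eq_zero`). Since the frame is finite, such values determine a multilinear
functional (`ext_single`). For `i > 1` no `j ≥ 0` satisfies the equation, so the whole coefficient
vanishes. For `i = 1` only `j = 0` survives: the coefficient vanishes as soon as one argument is a
`β`, hence it equals the pullback of its own restriction to the fields `α`. -/

/-- A multilinear functional of fields with finitely many components is determined by its values on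
fields with a single nonzero component. -/
theorem ext_single {C : Type*} [Fintype C] [DecidableEq C] {k : ℕ}
    {S T : ContinuousMultilinearMap 𝕜 (fun _ : Fin k => Fields 𝕜 ℓ C) R}
    (h : ∀ (c : Fin k → C) (f : Fin k → SmoothCircle 𝕜 ℓ),
      S (fun i => Pi.single (c i) (f i)) = T (fun i => Pi.single (c i) (f i))) : S = T := by
  ext φ
  have hφ : φ = fun i => ∑ c, Pi.single c (φ i c) :=
    funext fun i => (Finset.univ_sum_single (φ i)).symm
  -- Both sides expand over the choices `r` of one component for each argument.
  rw [hφ, ContinuousMultilinearMap.map_sum, ContinuousMultilinearMap.map_sum]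
  exact Finset.sum_congr rfl fun r _ => h r fun i => φ i (r i)

variable {ι : Type*} {dg : ι → ℤ}

/-- The inclusion `Ω^*(S¹) ⊗ 𝔤[1] → ℰ`. -/
noncomputable def extendAlpha : Fields 𝕜 ℓ (Bool × ι) →L[𝕜] Fields 𝕜 ℓ (Idx ι) :=
  ContinuousLinearMap.pi fun c => Sum.elim
    (fun a => (ContinuousLinearMap.proj (c.1, a) : Fields 𝕜 ℓ (Bool × ι) →L[𝕜] SmoothCircle 𝕜 ℓ))
    (fun _ => 0) c.2

/-- Preservation of degree is what keeps the restriction of a functional to the fields `α` graded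
symmetric, as `pullback` demands. -/
theorem isHomogeneousField_extendAlpha (p : ℤ) (φ : Fields 𝕜 ℓ (Bool × ι))
    (h : IsHomogeneousField (alphaDeg dg) p φ) :
    IsHomogeneousField (fieldDeg dg) p (extendAlpha φ) := by
  rintro ⟨s, a | a⟩ hc
  · exact h (s, a) hc
  · rfl

/-! ### The weight of a value on generators. -/

variable [DecidableEq ι]

/-- Two inversions cancel: the action on functionals uses `z⁻¹`, and the action on fields inverts
again on `β`, so a `β` contributes `z` and not `z⁻¹`. Written as a power with exponent 0 or 1, the
factors multiply to `z` to the number of `β`s. -/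
theorem fieldAction_inv_single (z : 𝕜ˣ) (c : Idx ι) (f : SmoothCircle 𝕜 ℓ) :
    fieldAction z⁻¹ (Pi.single c f : Fields 𝕜 ℓ (Idx ι)) =
      ((z : 𝕜) ^ (if c.2.isRight then 1 else 0)) • Pi.single c f := by
  funext c'
  by_cases h : c' = c
  · subst h
    rcases c' with ⟨s, a | a⟩ <;> simp [fieldAction]
  · simp [fieldAction, h]

variable [IsTopologicalRing R] [ContinuousSMul 𝕜 R]

/-- On generators of which `j` lie in `Ω^* ⊗ 𝔤^∨[-1]`, the coefficient of `ħ^i` of a functional of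
weight `1` vanishes unless `i + j = 1`. -/
theorem HasWeight.apply_single_eq_zero {F : HFunctionals 𝕜 ℓ R (fieldDeg dg)}
    (hF : HasWeight 1 F) {i k : ℕ} (c : Fin k → Idx ι) (f : Fin k → SmoothCircle 𝕜 ℓ)
    (h : i + (Finset.univ.filter fun a => (c a).2.isRight).card ≠ 1) :
    (F i k).1 (fun a => Pi.single (c a) (f a)) = 0 := by
  -- A single group element suffices, provided its powers with natural exponents are distinct; in
  -- characteristic zero 2 is such an element.
  have h2 : (2 : 𝕜) ≠ 0 := two_ne_zero
  have hw := congrArg (fun G : HFunctionals 𝕜 ℓ R (fieldDeg dg) =>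
    (G i k).1 (fun a => Pi.single (c a) (f a))) (hF (Units.mk0 2 h2))
  have hl : (muH (Units.mk0 (2 : 𝕜) h2) F i k).1 (fun a => Pi.single (c a) (f a)) =
      (2 : 𝕜) ^ i • (F i k).1
        (fun a => fieldAction (Units.mk0 (2 : 𝕜) h2)⁻¹ (Pi.single (c a) (f a))) := by
    simp only [muH, Units.val_pow_eq_pow_val, Units.val_mk0]
    rfl
  have hr : ((((Units.mk0 (2 : 𝕜) h2 ^ (1 : ℤ) : 𝕜ˣ) : 𝕜) • F) i k).1
      (fun a => Pi.single (c a) (f a)) =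
        (2 : 𝕜) • (F i k).1 (fun a => Pi.single (c a) (f a)) := by
    simp only [zpow_one, Units.val_mk0]
    rfl
  simp only [hl, hr, fieldAction_inv_single, Units.val_mk0] at hw
  -- Multilinearity extracts one scalar per argument, and their product is `2^j` with `j` the number
  -- of `β`s. Then `hw` says that `2^(i+j) - 2` annihilates the value.
  rw [ContinuousMultilinearMap.map_smul_univ, Finset.prod_pow_eq_pow_sum, ← Finset.card_filter,
    smul_smul, ← pow_add, ← sub_eq_zero, ← sub_smul] at hw
  -- `R` is a vector space over `𝕜`, so it remains to exclude that the scalar is zero; the equation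
  -- `2^(i+j) = 2` descends to `ℕ`, where it gives `i + j = 1`.
  refine (smul_eq_zero.1 hw).resolve_left fun h0 => h ?_
  have h1 : (2 : ℕ) ^ (i + (Finset.univ.filter fun a => (c a).2.isRight).card) = 2 ^ 1 := by
    exact_mod_cast (sub_eq_zero.1 h0).trans (pow_one (2 : 𝕜)).symm
  exact Nat.pow_right_injective le_rfl h1

/-! ### Vanishing beyond order one, and dependence on `α` alone at order one. -/

/-- The composite is the projection of the fields onto their `α` part, which kills every `β`. -/
theorem extendAlpha_alphaPart_single (c : Idx ι) (f : SmoothCircle 𝕜 ℓ) :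
    extendAlpha (alphaPart (Pi.single c f : Fields 𝕜 ℓ (Idx ι))) =
      if c.2.isRight then 0 else Pi.single c f := by
  funext c'
  rcases c with ⟨s, a | a⟩ <;> rcases c' with ⟨s', a' | a'⟩ <;>
    simp [extendAlpha, alphaPart, Pi.single_apply]

/-- The number of `β`s is nonnegative, so it cannot compensate for an excess of `ħ`. -/
theorem HasWeight.eq_zero [Fintype ι] {F : HFunctionals 𝕜 ℓ R (fieldDeg dg)}
    (hF : HasWeight 1 F) {i : ℕ} (hi : 1 < i) : F i = 0 := by
  funext k
  refine Subtype.ext (ext_single fun c f => ?_)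
  exact hF.apply_single_eq_zero c f (by omega)

theorem HasWeight.mem_range_inclAlpha [Fintype ι] {F : HFunctionals 𝕜 ℓ R (fieldDeg dg)}
    (hF : HasWeight 1 F) :
    F 1 ∈ Set.range (inclAlpha :
      Functionals 𝕜 ℓ R (alphaDeg dg) → Functionals 𝕜 ℓ R (fieldDeg dg)) := by
  -- The preimage is the restriction to `β = 0`; what must be checked is that precomposing with the
  -- projection onto `α` does not change the functional.
  refine ⟨pullback extendAlpha isHomogeneousField_extendAlpha (F 1), ?_⟩
  funext k
  refine Subtype.ext (ext_single fun c f => ?_)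
  change (F 1 k).1 (fun a => extendAlpha (alphaPart (Pi.single (c a) (f a)))) = _
  simp only [extendAlpha_alphaPart_single]
  by_cases h : ∃ a, (c a).2.isRight
  · obtain ⟨a, ha⟩ := h
    -- With a `β` among the arguments both sides vanish: the left has a zero argument, and the right
    -- has `i = 1` and `j ≥ 1`.
    rw [(F 1 k).1.map_coord_zero a (by simp [ha]), hF.apply_single_eq_zero c f]
    have : 0 < (Finset.univ.filter fun a => (c a).2.isRight).card :=
      Finset.card_pos.2 ⟨a, by simp [ha]⟩
    omega
  -- Without a `β` the projection fixes every argument.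
  · push Not at h
    simp [h]

end Weights

end OneDimCS

theorem mainTheorem6
    {𝕜 : Type*} [RCLike 𝕜] (ℓ : ℝ) (hℓ : 0 < ℓ)
    {R : Type*} [Ring R] [Algebra 𝕜 R] [UniformSpace R] [IsUniformAddGroup R]
    [IsTopologicalRing R] [ContinuousSMul 𝕜 R] [T2Space R] [CompleteSpace R]
    [Module ℝ R] [IsScalarTower ℝ 𝕜 R] [LocallyConvexSpace ℝ R]
    (𝒜 : ℤ → Submodule 𝕜 R) [GradedAlgebra 𝒜] (B : OneDimCS.DGBase 𝕜 R 𝒜)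
    {ι : Type*} [Fintype ι] [DecidableEq ι] (dg : ι → ℤ) (g : OneDimCS.CurvedLInfinity B dg)
    (I : ℝ → OneDimCS.HFunctionals 𝕜 ℓ R (OneDimCS.fieldDeg dg))
    (hI : OneDimCS.IsQuantization g I) (hG : OneDimCS.IsGmInvariant I) :
    ∀ L : ℝ, 0 < L →
      (∀ i : ℕ, 1 < i → I L i = 0) ∧
      I L 1 ∈ Set.range (OneDimCS.inclAlpha :
        OneDimCS.Functionals 𝕜 ℓ R (OneDimCS.alphaDeg dg) →
          OneDimCS.Functionals 𝕜 ℓ R (OneDimCS.fieldDeg dg)) := by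
  intro L hL
  exact ⟨fun i hi => (hG L hL).eq_zero hi, (hG L hL).mem_range_inclAlpha⟩
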